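/- Let $n\in\{2,3\}$, let $k\ge 1$ be an integer, let $0<r_1<r_2<r_3<R$, and put $\omega=B(r_1)$, $B=B(r_2)$, $\Omega=B(r_3)$, where $B(r)\subset\mathbb R^n$ is the open ball of radius $r$ centred at the origin. Let $$\alpha=\frac{\log r_3-\log r_2}{\log r_3-\log r_1}\in(0,1),$$ the optimal exponent in the three-ball inequality $\|u\|_{L^2(B(r_2))}\le\|u\|_{L^2(B(r_1))}^{\alpha}\|u\|_{L^2(B(r_3))}^{1-\alpha}$ for harmonic functions. Let $\{F_h\}_{h>0}$ be any family of (not necessarily linear or continuous) maps $F_h:L^2(\omega)\to H^1(\Omega)$. For $\alpha_1,\alpha_2\in(0,1)$ consider the error bound $$\|u-F_h(u|_\omega+\delta q)\|_{L^2(B)}\le C\Big(h^{\alpha_1 k}\|u\|_{H^{k+1}(\Omega)}+h^{(\alpha_2-1)k}\|\delta q\|_{L^2(\omega)}\Big)\qquad(*)$$ required for all $h>0$, all $\delta q\in L^2(\omega)$ and all $u\in H^{k+1}(B(R))$ with $\Delta u=0$ in $B(R)$, with a constant $C$ independent of $h$, $u$ and $\delta q$. Then there are no $\alpha_1,\alpha_2\in(0,1)$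 with $\frac{\alpha_1}{1+\alpha_1-\alpha_2}>\alpha$ for which $(*)$ holds with some $C$. In particular, there are no $\alpha_1,\alpha_2\in[\alpha,1)$ with $\alpha_1>\alpha$ or $\alpha_2>\alpha$ for which $(*)$ holds with some $C$. -/

import Mathlib

open MeasureTheory

noncomputable section

/-- Euclidean space `ℝⁿ`. -/
abbrev Euc (n : ℕ) : Type := EuclideanSpace ℝ (Fin n)

/-- The `i`-th partial derivative of `f`. -/
def partialDeriv {n : ℕ} (i : Fin n) (f : Euc n → ℝ) : Euc n → ℝ :=
  fun x => fderiv ℝ f x (EuclideanSpace.single i 1)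

/-- The classical derivative `D^a f = ∂₁^{a₁} ⋯ ∂ₙ^{aₙ} f` for a multi-index `a`. -/
def multiDeriv {n : ℕ} (a : Fin n → ℕ) (f : Euc n → ℝ) : Euc n → ℝ :=
  (List.finRange n).foldr (fun i g => (partialDeriv i)^[a i] g) f

/-- `g` is a weak derivative `D^a u` of `u` in the open set `U`: both are locally integrable and
`∫_U u D^a φ = (-1)^{|a|} ∫_U g φ` for all test functions `φ ∈ C_c^∞(U)`. -/
def HasWeakDeriv {n : ℕ} (U : Set (Euc n)) (a : Fin n → ℕ) (u g : Euc n → ℝ) : Prop :=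
  LocallyIntegrableOn u U volume ∧ LocallyIntegrableOn g U volume ∧
    ∀ φ : Euc n → ℝ, ContDiff ℝ (⊤ : ℕ∞) φ → HasCompactSupport φ → tsupport φ ⊆ U →
      ∫ x in U, u x * multiDeriv a φ x = (-1 : ℝ) ^ (∑ i, a i) * ∫ x in U, g x * φ x

open Classical in
/-- The weak derivative `D^a u` in `U` (unique up to null sets), and `0` if there is none. -/
def weakDeriv {n : ℕ} (U : Set (Euc n)) (a : Fin n → ℕ) (u : Euc n → ℝ) : Euc n → ℝ :=
  if h : ∃ g, HasWeakDeriv U a u g then h.choose else 0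

/-- `u ∈ H^m(U)`: `u` lies in `L²(U)` and has weak derivatives in `L²(U)` up to order `m`. -/
def MemH {n : ℕ} (m : ℕ) (U : Set (Euc n)) (u : Euc n → ℝ) : Prop :=
  MemLp u 2 (volume.restrict U) ∧
    ∀ a : Fin n → ℕ, ∑ i, a i ≤ m →
      ∃ g, HasWeakDeriv U a u g ∧ MemLp g 2 (volume.restrict U)

/-- `L²(U)`. -/
abbrev L2Space {n : ℕ} (U : Set (Euc n)) : Type := Lp ℝ 2 ((volume : Measure (Euc n)).restrict U)

/-- The Sobolev space `H^m(U)`, as a set of elements of `L²(U)`. -/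
def SobolevH {n : ℕ} (m : ℕ) (U : Set (Euc n)) : Set (L2Space U) := {v | MemH m U v}

/-- The `L²(U)`-norm of a function (meaningful for functions in `L²(U)`). -/
def l2Norm {n : ℕ} (U : Set (Euc n)) (f : Euc n → ℝ) : ℝ :=
  (eLpNorm f 2 (volume.restrict U)).toReal

/-- The norm `(∑_{|a| ≤ m} ‖D^a u‖²_{L²(U)})^{1/2}` of `u ∈ H^m(U)`. -/
def hNorm {n : ℕ} (m : ℕ) (U : Set (Euc n)) (u : Euc n → ℝ) : ℝ :=
  √(∑ j ∈ Finset.range (m + 1), ∑ a ∈ Finset.piAntidiag (Finset.univ : Finset (Fin n)) j,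
    l2Norm U (weakDeriv U a u) ^ 2)

/-- The open ball `B(r)` in `ℝⁿ` centred at the origin. -/
abbrev ballB (n : ℕ) (r : ℝ) : Set (Euc n) := Metric.ball 0 r

/-- The optimal exponent in the three-ball inequality
`‖u‖_{L²(B(r₂))} ≤ ‖u‖_{L²(B(r₁))}^α ‖u‖_{L²(B(r₃))}^{1-α}` for harmonic functions. -/
def threeBallExponent (r₁ r₂ r₃ : ℝ) : ℝ :=
  (Real.log r₃ - Real.log r₂) / (Real.log r₃ - Real.log r₁)

/-- The error bound
`‖u - F_h(q + δq)‖_{L²(B(r₂))} ≤ C (h^{α₁k} ‖u‖_{H^{k+1}(B(r₃))} + h^{(α₂-1)k} ‖δq‖_{L²(B(r₁))})`,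
with `C` independent of `h > 0`, of the perturbation `δq ∈ L²(B(r₁))` and of the function
`u ∈ H^{k+1}(B(R))` harmonic in `B(R)`, where `q = u|_{B(r₁)}`. -/
def ErrorBound (n k : ℕ) (r₁ r₂ r₃ R : ℝ)
    (F : {h : ℝ // 0 < h} → L2Space (ballB n r₁) → SobolevH 1 (ballB n r₃)) (α₁ α₂ : ℝ) : Prop :=
  ∃ C : ℝ, ∀ (h : {h : ℝ // 0 < h}) (u : Euc n → ℝ) (q δq : L2Space (ballB n r₁)),
    MemH (k + 1) (ballB n R) u → InnerProductSpace.HarmonicOnNhd u (ballB n R) →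
    q =ᵐ[volume.restrict (ballB n r₁)] u →
    l2Norm (ballB n r₂) (fun x => u x - (F h (q + δq) : L2Space (ballB n r₃)) x) ≤
      C * ((h : ℝ) ^ (α₁ * k) * hNorm (k + 1) (ballB n r₃) u
        + (h : ℝ) ^ ((α₂ - 1) * k) * ‖δq‖)

end

/-!
Write `z = x₁ + √-1 x₂`. The functions `Re (c zᴺ)` are harmonic on all of `ℝⁿ`, of size about `rᴺ`
on the ball `B(r)`, and this family is closed under differentiation, so that Sobolev norms cost
only a factor polynomial in `N` (`exists_hNorm_planeHarmonic_le`).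

Whatever the maps `F_h` are, the error bound for `u = 0`, `δq = 0` gives `F_h(0) = 0` on `B(r₂)`,
and the perturbation `δq = -u|_{B(r₁)}` turns it into the linear estimate
`‖u‖_{B(r₂)} ≤ C (h^{α₁k} ‖u‖_{H^{k+1}(B(r₃))} + h^{(α₂-1)k} ‖u‖_{B(r₁)})`
(`ErrorBound.exists_stability`). For `u = Re zᴺ, Im zᴺ` choose `h` such that both terms on the right
agree up to polynomial factors; then they are `ρᴺ` with `ρ = r₃ (r₁/r₃)^β` and
`β = α₁ / (1 + α₁ - α₂)` (`exists_balancing_scale`). If `β` exceeds the three-ball exponent, then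
`ρ < r₂`, whereas the left-hand side grows at least like `sᴺ` for every `s < r₂`
(`exists_le_l2Norm_planeHarmonic`): a contradiction as `N → ∞`.

The norm `hNorm` is defined through a chosen weak derivative. It is identified with the explicit
derivatives by integration by parts (`exists_hasWeakDeriv_planeHarmonic`) and the uniqueness of weak
derivatives (`HasWeakDeriv.ae_eq`).
-/

/-! ### The harmonic functions `Re (c zᵐ)` -/

/-- The complex coordinate `z = xᵢ + √-1 xⱼ` on `ℝⁿ`. -/
noncomputable def planeCoord {n : ℕ} (i j : Fin n) : Euc n →L[ℝ] ℂ :=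
  Complex.ofRealCLM.comp (EuclideanSpace.proj i) +
    Complex.I • Complex.ofRealCLM.comp (EuclideanSpace.proj j)

/-- The function `Re (c zᵐ)` on `ℝⁿ`, where `z = xᵢ + √-1 xⱼ`. -/
noncomputable def planeHarmonic {n : ℕ} (i j : Fin n) (c : ℂ) (m : ℕ) (x : Euc n) : ℝ :=
  (c * planeCoord i j x ^ m).re

lemma planeCoord_apply {n : ℕ} (i j : Fin n) (x : Euc n) :
    planeCoord i j x = (x i : ℂ) + Complex.I * (x j : ℂ) := by
  simp [planeCoord]

lemma planeCoord_single {n : ℕ} {i j : Fin n} (hij : i ≠ j) (l : Fin n) :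
    planeCoord i j (EuclideanSpace.single l 1) =
      if l = i then 1 else if l = j then Complex.I else 0 := by
  rw [planeCoord_apply]
  by_cases h : l = i
  · subst h; simp [hij.symm]
  · by_cases h' : l = j
    · subst h'; simp [h, hij]
    · simp [h, h', Ne.symm h, Ne.symm h']

lemma norm_planeCoord_single_le {n : ℕ} {i j : Fin n} (hij : i ≠ j) (l : Fin n) :
    ‖planeCoord i j (EuclideanSpace.single l 1)‖ ≤ 1 := by
  rw [planeCoord_single hij]
  split_ifs <;> simp

lemma norm_planeCoord_le {n : ℕ} {i j : Fin n} (hij : i ≠ j) (x : Euc n) :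
    ‖planeCoord i j x‖ ≤ ‖x‖ := by
  rw [planeCoord_apply, EuclideanSpace.norm_eq, mul_comm, Complex.norm_add_mul_I]
  refine Real.sqrt_le_sqrt ?_
  have := Finset.sum_le_sum_of_subset_of_nonneg (Finset.subset_univ {i, j})
    (f := fun l => ‖x l‖ ^ 2) (fun _ _ _ => by positivity)
  simpa [Finset.sum_pair hij] using this

lemma contDiff_planeHarmonic {n : ℕ} (i j : Fin n) (c : ℂ) (m : ℕ) :
    ContDiff ℝ (⊤ : ℕ∞) (planeHarmonic i j c m) := by
  have h : ContDiff ℝ (⊤ : ℕ∞) fun x => c * planeCoord i j x ^ m :=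
    contDiff_const.mul ((planeCoord i j).contDiff.pow m)
  exact Complex.reCLM.contDiff.comp h

lemma continuous_planeHarmonic {n : ℕ} (i j : Fin n) (c : ℂ) (m : ℕ) :
    Continuous (planeHarmonic i j c m) :=
  (contDiff_planeHarmonic i j c m).continuous

/-- The functions `Re (c zᵐ)` are closed under differentiation. -/
lemma fderiv_planeHarmonic {n : ℕ} (i j : Fin n) (c : ℂ) (m : ℕ) (x v : Euc n) :
    fderiv ℝ (planeHarmonic i j c m) x v =
      planeHarmonic i j (c * m * planeCoord i j v) (m - 1) x := by
  have h := Complex.reCLM.hasFDerivAt.comp x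
    ((((planeCoord i j).hasFDerivAt (x := x)).pow m).const_mul c)
  have h' : HasFDerivAt (planeHarmonic i j c m) _ x := h
  rw [h'.fderiv]
  simp only [planeHarmonic, ContinuousLinearMap.comp_apply, smul_apply,
    Complex.reCLM_apply, smul_eq_mul, nsmul_eq_mul]
  congr 1
  ring

lemma abs_planeHarmonic_le {n : ℕ} {i j : Fin n} (hij : i ≠ j) (c : ℂ) (m : ℕ) {r : ℝ}
    {x : Euc n} (hx : x ∈ ballB n r) : ‖planeHarmonic i j c m x‖ ≤ ‖c‖ * r ^ m := by
  have hx' : ‖x‖ ≤ r := by simpa using (mem_ball_zero_iff.1 hx).le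
  calc ‖planeHarmonic i j c m x‖ ≤ ‖c * planeCoord i j x ^ m‖ := Complex.abs_re_le_norm _
    _ = ‖c‖ * ‖planeCoord i j x‖ ^ m := by rw [norm_mul, norm_pow]
    _ ≤ ‖c‖ * r ^ m := by
      gcongr
      exact (norm_planeCoord_le hij x).trans hx'

lemma harmonicOnNhd_planeHarmonic {n : ℕ} {i j : Fin n} (hij : i ≠ j) (c : ℂ) (m : ℕ)
    (s : Set (Euc n)) : InnerProductSpace.HarmonicOnNhd (planeHarmonic i j c m) s := by
  intro x _
  refine ⟨(contDiff_infty.1 (contDiff_planeHarmonic i j c m) 2).contDiffAt,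
    Filter.Eventually.of_forall fun y => ?_⟩
  have hd : Differentiable ℝ (fderiv ℝ (planeHarmonic i j c m)) :=
    (contDiff_infty_iff_fderiv.1 (contDiff_planeHarmonic i j c m)).2.differentiable (by simp)
  -- the second derivative of `Re (c zᵐ)` in direction `v` carries the factor `z(v)²`
  have hsec (v : Euc n) : fderiv ℝ (fderiv ℝ (planeHarmonic i j c m)) y v v =
      (c * m * (m - 1 : ℕ) * planeCoord i j y ^ (m - 1 - 1) * planeCoord i j v ^ 2).re := by
    have h1 : fderiv ℝ (fun w => fderiv ℝ (planeHarmonic i j c m) w v) y v =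
        fderiv ℝ (fderiv ℝ (planeHarmonic i j c m)) y v v := by
      rw [fderiv_clm_apply (hd y) (differentiableAt_const v)]
      simp
    rw [← h1, funext fun w => fderiv_planeHarmonic i j c m w v, fderiv_planeHarmonic]
    simp only [planeHarmonic]
    congr 1
    ring
  have hsum : ∑ l, planeCoord i j (EuclideanSpace.single l 1) ^ 2 = 0 := by
    have : ∀ l, planeCoord i j (EuclideanSpace.single l 1) ^ 2 =
        (if l = i then 1 else 0) + (if l = j then -1 else 0) := by
      intro l
      rw [planeCoord_single hij]
      by_cases h : l = i
      · simp [h, hij]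
      · by_cases h' : l = j <;> simp [h, h', hij.symm]
    simp [this, Finset.sum_add_distrib]
  rw [InnerProductSpace.laplacian_eq_iteratedFDeriv_orthonormalBasis _
    (EuclideanSpace.basisFun (Fin n) ℝ)]
  simp only [iteratedFDeriv_two_apply, EuclideanSpace.basisFun_apply, Matrix.cons_val_zero,
    Matrix.cons_val_one, hsec, ← Complex.re_sum, ← Finset.mul_sum, hsum]
  simp

/-! ### Weak derivatives -/

/-- `φ` is a test function in `U`: smooth, with compact support contained in `U`. -/
def IsTestFunction {n : ℕ} (U : Set (Euc n)) (φ : Euc n → ℝ) : Prop :=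
  ContDiff ℝ (⊤ : ℕ∞) φ ∧ HasCompactSupport φ ∧ tsupport φ ⊆ U

lemma IsTestFunction.partialDeriv {n : ℕ} {U : Set (Euc n)} {φ : Euc n → ℝ}
    (h : IsTestFunction U φ) (l : Fin n) : IsTestFunction U (partialDeriv l φ) :=
  ⟨(contDiff_infty_iff_fderiv.1 h.1).2.clm_apply contDiff_const, h.2.1.fderiv_apply ℝ _,
    (tsupport_fderiv_apply_subset ℝ _).trans h.2.2⟩

lemma IsTestFunction.iterate_partialDeriv {n : ℕ} {U : Set (Euc n)} {φ : Euc n → ℝ}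
    (h : IsTestFunction U φ) (l : Fin n) (p : ℕ) :
    IsTestFunction U ((_root_.partialDeriv l)^[p] φ) := by
  induction p generalizing φ with
  | zero => exact h
  | succ p ih => exact ih (h.partialDeriv l)

lemma IsTestFunction.foldr_partialDeriv {n : ℕ} {U : Set (Euc n)} {φ : Euc n → ℝ}
    (h : IsTestFunction U φ) (a : Fin n → ℕ) (L : List (Fin n)) :
    IsTestFunction U (L.foldr (fun i g => (_root_.partialDeriv i)^[a i] g) φ) := by
  induction L with
  | nil => exact h
  | cons l L ih => exact ih.iterate_partialDeriv l (a l)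

lemma IsTestFunction.setIntegral_mul {n : ℕ} {U : Set (Euc n)} {φ : Euc n → ℝ}
    (h : IsTestFunction U φ) (f : Euc n → ℝ) : ∫ x in U, f x * φ x = ∫ x, f x * φ x :=
  setIntegral_eq_integral_of_forall_compl_eq_zero fun x hx => by
    rw [image_eq_zero_of_notMem_tsupport fun hx' => hx (h.2.2 hx'), mul_zero]

lemma IsTestFunction.integrable_mul {n : ℕ} {U : Set (Euc n)} {φ f : Euc n → ℝ}
    (h : IsTestFunction U φ) (hf : Continuous f) : Integrable fun x => f x * φ x :=
  (hf.mul h.1.continuous).integrable_of_hasCompactSupport h.2.1.mul_left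

/-- Moving one partial derivative from the test function onto `Re (c zᵐ)` yields a function
`Re (c' zᵐ')` of the same kind; the size `|c| rᵐ` grows by a factor of at most `N / r`. -/
lemma exists_integral_partialDeriv {n : ℕ} {i j : Fin n} (hij : i ≠ j) (U : Set (Euc n)) {r : ℝ}
    (hr : 0 < r) {N : ℕ} (l : Fin n) {c : ℂ} {m : ℕ} {K : ℝ} (hm : m ≤ N)
    (hK : ‖c‖ * r ^ m ≤ K) :
    ∃ (c' : ℂ) (m' : ℕ), m' ≤ N ∧ ‖c'‖ * r ^ m' ≤ K * (N / r) ∧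
      ∀ φ, IsTestFunction U φ → ∫ x, planeHarmonic i j c m x * partialDeriv l φ x =
        -∫ x, planeHarmonic i j c' m' x * φ x := by
  refine ⟨c * m * planeCoord i j (EuclideanSpace.single l 1), m - 1, by omega, ?_, ?_⟩
  · have hK0 : 0 ≤ K := le_trans (by positivity) hK
    have hmN : (m : ℝ) ≤ N := by exact_mod_cast hm
    rcases Nat.eq_zero_or_pos m with rfl | hm0
    · simp only [Nat.cast_zero, mul_zero, zero_mul, norm_zero]
      positivity
    · have hpow : r ^ (m - 1) = r ^ m / r := by
        rw [eq_div_iff hr.ne', ← pow_succ, Nat.sub_add_cancel hm0]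
      calc ‖c * m * planeCoord i j (EuclideanSpace.single l 1)‖ * r ^ (m - 1)
          ≤ ‖c‖ * m * 1 * r ^ (m - 1) := by
            rw [norm_mul, norm_mul, Complex.norm_natCast]
            gcongr
            exact norm_planeCoord_single_le hij l
        _ = (‖c‖ * r ^ m) * (m / r) := by rw [hpow]; ring
        _ ≤ K * (N / r) := by gcongr
  · intro φ hφ
    have hf' : (fun x => fderiv ℝ (planeHarmonic i j c m) x (EuclideanSpace.single l 1)) =
        planeHarmonic i j (c * m * planeCoord i j (EuclideanSpace.single l 1)) (m - 1) :=
      funext fun x => fderiv_planeHarmonic i j c m x _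
    have hparts := integral_mul_fderiv_eq_neg_fderiv_mul_of_integrable (μ := volume)
      (f := planeHarmonic i j c m) (g := φ) (v := EuclideanSpace.single l 1)
      (by simp only [congrFun hf']; exact hφ.integrable_mul (continuous_planeHarmonic ..))
      ((hφ.partialDeriv l).integrable_mul (continuous_planeHarmonic ..))
      (hφ.integrable_mul (continuous_planeHarmonic ..))
      (fun x _ => (contDiff_planeHarmonic i j c m).differentiable (by simp) x)
      (fun x _ => hφ.1.differentiable (by simp) x)
    simp only [congrFun hf'] at hparts
    exact hparts

lemma exists_integral_iterate_partialDeriv {n : ℕ} {i j : Fin n} (hij : i ≠ j)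
    (U : Set (Euc n)) {r : ℝ} (hr : 0 < r) {N : ℕ} (l : Fin n) (p : ℕ) {c : ℂ} {m : ℕ} {K : ℝ}
    (hm : m ≤ N) (hK : ‖c‖ * r ^ m ≤ K) :
    ∃ (c' : ℂ) (m' : ℕ), m' ≤ N ∧ ‖c'‖ * r ^ m' ≤ K * (N / r) ^ p ∧
      ∀ φ, IsTestFunction U φ → ∫ x, planeHarmonic i j c m x * (partialDeriv l)^[p] φ x =
        (-1) ^ p * ∫ x, planeHarmonic i j c' m' x * φ x := by
  induction p with
  | zero => exact ⟨c, m, hm, by simpa using hK, fun φ _ => by simp⟩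
  | succ p ih =>
    obtain ⟨c₁, m₁, hm₁, hK₁, h₁⟩ := ih
    obtain ⟨c₂, m₂, hm₂, hK₂, h₂⟩ := exists_integral_partialDeriv hij U hr l hm₁ hK₁
    refine ⟨c₂, m₂, hm₂, hK₂.trans_eq (by ring), fun φ hφ => ?_⟩
    rw [Function.iterate_succ_apply, h₁ _ (hφ.partialDeriv l), h₂ φ hφ]
    ring

lemma exists_integral_foldr_partialDeriv {n : ℕ} {i j : Fin n} (hij : i ≠ j)
    (U : Set (Euc n)) {r : ℝ} (hr : 0 < r) {N : ℕ} (a : Fin n → ℕ) (L : List (Fin n)) {c : ℂ}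
    {m : ℕ} {K : ℝ} (hm : m ≤ N) (hK : ‖c‖ * r ^ m ≤ K) :
    ∃ (c' : ℂ) (m' : ℕ), m' ≤ N ∧ ‖c'‖ * r ^ m' ≤ K * (N / r) ^ (L.map a).sum ∧
      ∀ φ, IsTestFunction U φ →
        ∫ x, planeHarmonic i j c m x * L.foldr (fun i g => (partialDeriv i)^[a i] g) φ x =
          (-1) ^ (L.map a).sum * ∫ x, planeHarmonic i j c' m' x * φ x := by
  induction L generalizing c m K with
  | nil => exact ⟨c, m, hm, by simpa using hK, fun φ _ => by simp⟩
  | cons l L ih =>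
    obtain ⟨c₁, m₁, hm₁, hK₁, h₁⟩ :=
      exists_integral_iterate_partialDeriv hij U hr l (a l) hm hK
    obtain ⟨c₂, m₂, hm₂, hK₂, h₂⟩ := ih hm₁ hK₁
    refine ⟨c₂, m₂, hm₂, hK₂.trans_eq ?_, fun φ hφ => ?_⟩
    · rw [List.map_cons, List.sum_cons, pow_add, mul_assoc]
    · rw [List.foldr_cons, h₁ _ (hφ.foldr_partialDeriv a L), h₂ φ hφ, List.map_cons,
        List.sum_cons, pow_add, mul_assoc]

/-- Every weak derivative of `Re (c zᵐ)` is again of this form, with the expected growth. -/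
lemma exists_hasWeakDeriv_planeHarmonic {n : ℕ} {i j : Fin n} (hij : i ≠ j) (U : Set (Euc n))
    {r : ℝ} (hr : 0 < r) (c : ℂ) (N : ℕ) (a : Fin n → ℕ) :
    ∃ (c' : ℂ) (m' : ℕ), ‖c'‖ * r ^ m' ≤ ‖c‖ * r ^ N * (N / r) ^ (∑ i, a i) ∧
      HasWeakDeriv U a (planeHarmonic i j c N) (planeHarmonic i j c' m') := by
  obtain ⟨c', m', -, hK, h⟩ := exists_integral_foldr_partialDeriv hij U hr a (List.finRange n)
    (le_refl N) (le_refl (‖c‖ * r ^ N))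
  rw [← Fin.sum_univ_def] at hK h
  refine ⟨c', m', hK, (continuous_planeHarmonic ..).locallyIntegrable.locallyIntegrableOn U,
    (continuous_planeHarmonic ..).locallyIntegrable.locallyIntegrableOn U,
    fun φ h₁ h₂ h₃ => ?_⟩
  have hφ : IsTestFunction U φ := ⟨h₁, h₂, h₃⟩
  have hφ' : IsTestFunction U (multiDeriv a φ) := hφ.foldr_partialDeriv a (List.finRange n)
  rw [hφ.setIntegral_mul, hφ'.setIntegral_mul]
  exact h φ hφ

lemma HasWeakDeriv.ae_eq {n : ℕ} {U : Set (Euc n)} (hU : IsOpen U) {a : Fin n → ℕ}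
    {u g₁ g₂ : Euc n → ℝ} (h₁ : HasWeakDeriv U a u g₁) (h₂ : HasWeakDeriv U a u g₂) :
    g₁ =ᵐ[volume.restrict U] g₂ := by
  have h := hU.ae_eq_zero_of_integral_contDiff_smul_eq_zero (h₁.2.1.sub h₂.2.1)
    fun φ hφ₁ hφ₂ hφ₃ => by
      have hφ : IsTestFunction U φ := ⟨hφ₁, hφ₂, hφ₃⟩
      have hint {g : Euc n → ℝ} (hg : LocallyIntegrableOn g U volume) :
          Integrable fun x => φ x • g x := by
        have hK : IntegrableOn (fun x => φ x • g x) (tsupport φ) :=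
          (hg.integrableOn_compact_subset hφ₃ hφ₂).continuousOn_mul hφ₁.continuous.continuousOn hφ₂
        refine (integrableOn_iff_integrable_of_support_subset fun x hx => ?_).1 hK
        exact subset_tsupport φ fun h0 => hx (by simp [h0])
      have heq := (h₁.2.2 φ hφ₁ hφ₂ hφ₃).symm.trans (h₂.2.2 φ hφ₁ hφ₂ hφ₃)
      rw [hφ.setIntegral_mul, hφ.setIntegral_mul] at heq
      have heq' := mul_left_cancel₀ (pow_ne_zero _ (by norm_num : (-1 : ℝ) ≠ 0)) heq
      simp only [Pi.sub_apply, smul_sub]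
      rw [integral_sub (hint h₁.2.1) (hint h₂.2.1), sub_eq_zero]
      simpa only [smul_eq_mul, mul_comm] using heq'
  rw [Filter.EventuallyEq, ae_restrict_iff' hU.measurableSet]
  filter_upwards [h] with x hx hxU
  exact sub_eq_zero.1 (hx hxU)

lemma HasWeakDeriv.weakDeriv_ae_eq {n : ℕ} {U : Set (Euc n)} (hU : IsOpen U) {a : Fin n → ℕ}
    {u g : Euc n → ℝ} (h : HasWeakDeriv U a u g) :
    weakDeriv U a u =ᵐ[volume.restrict U] g := by
  have hex : ∃ g, HasWeakDeriv U a u g := ⟨g, h⟩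
  rw [weakDeriv, dif_pos hex]
  exact hex.choose_spec.ae_eq hU h

/-! ### Norms of `Re (c zᵐ)` on balls -/

instance isFiniteMeasure_restrict_ballB {n : ℕ} (r : ℝ) :
    IsFiniteMeasure ((volume : Measure (Euc n)).restrict (ballB n r)) :=
  isFiniteMeasure_restrict.2 measure_ball_lt_top.ne

lemma memLp_planeHarmonic {n : ℕ} {i j : Fin n} (hij : i ≠ j) (c : ℂ) (m : ℕ) (r : ℝ) :
    MemLp (planeHarmonic i j c m) 2 (volume.restrict (ballB n r)) := by
  refine MemLp.of_bound (continuous_planeHarmonic i j c m).aestronglyMeasurable (‖c‖ * r ^ m) ?_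
  filter_upwards [ae_restrict_mem measurableSet_ball] with x hx
  exact abs_planeHarmonic_le hij c m hx

lemma exists_l2Norm_planeHarmonic_le {n : ℕ} {i j : Fin n} (hij : i ≠ j) {r : ℝ} (hr : 0 < r) :
    ∃ V : ℝ, 0 ≤ V ∧ ∀ (c : ℂ) (m : ℕ),
      l2Norm (ballB n r) (planeHarmonic i j c m) ≤ V * (‖c‖ * r ^ m) := by
  have hfin : volume.restrict (ballB n r) Set.univ ^ (2 : ENNReal).toReal⁻¹ ≠ ⊤ :=
    ENNReal.rpow_ne_top_of_nonneg (by simp) (measure_ne_top _ _)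
  refine ⟨(volume.restrict (ballB n r) Set.univ ^ (2 : ENNReal).toReal⁻¹).toReal,
    ENNReal.toReal_nonneg, fun c m => ?_⟩
  have h := eLpNorm_le_of_ae_bound (p := 2) (μ := volume.restrict (ballB n r))
    (f := planeHarmonic i j c m) (C := ‖c‖ * r ^ m) (by
      filter_upwards [ae_restrict_mem measurableSet_ball] with x hx
      exact abs_planeHarmonic_le hij c m hx)
  refine (ENNReal.toReal_mono (ENNReal.mul_ne_top hfin ENNReal.ofReal_ne_top) h).trans_eq ?_
  rw [ENNReal.toReal_mul, ENNReal.toReal_ofReal (by positivity)]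

lemma memH_planeHarmonic {n : ℕ} {i j : Fin n} (hij : i ≠ j) (c : ℂ) (N M : ℕ) (r : ℝ) :
    MemH M (ballB n r) (planeHarmonic i j c N) := by
  refine ⟨memLp_planeHarmonic hij c N r, fun a _ => ?_⟩
  obtain ⟨c', m', -, h⟩ :=
    exists_hasWeakDeriv_planeHarmonic hij (ballB n r) one_pos c N a
  exact ⟨_, h, memLp_planeHarmonic hij c' m' r⟩

/-- The Sobolev norms of `Re (c zᴺ)` on a ball of radius `r` exceed `|c| rᴺ` by at most a factor
polynomial in `N`. -/
lemma exists_hNorm_planeHarmonic_le {n : ℕ} {i j : Fin n} (hij : i ≠ j) (M : ℕ) {r : ℝ}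
    (hr : 0 < r) : ∃ A : ℝ, 0 ≤ A ∧ ∀ (c : ℂ) (N : ℕ),
      hNorm M (ballB n r) (planeHarmonic i j c N) ≤ A * (‖c‖ * r ^ N * (1 + N / r) ^ M) := by
  obtain ⟨V, hV, hVle⟩ := exists_l2Norm_planeHarmonic_le hij hr
  set T : ℝ := ∑ j ∈ Finset.range (M + 1),
    ∑ _a ∈ Finset.piAntidiag (Finset.univ : Finset (Fin n)) j, (1 : ℝ) with hT
  refine ⟨√T * V, mul_nonneg (Real.sqrt_nonneg T) hV, fun c N => ?_⟩
  set L : ℝ := ‖c‖ * r ^ N * (1 + N / r) ^ M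
  have hL0 : 0 ≤ L := by positivity
  have hterm : ∀ p ∈ Finset.range (M + 1),
      ∀ a ∈ Finset.piAntidiag (Finset.univ : Finset (Fin n)) p,
        l2Norm (ballB n r) (weakDeriv (ballB n r) a (planeHarmonic i j c N)) ^ 2 ≤
          (V * L) ^ 2 * 1 := by
    intro p hp a ha
    obtain ⟨c', m', hK, hw⟩ := exists_hasWeakDeriv_planeHarmonic hij (ballB n r) hr c N a
    have hsum : ∑ l, a l ≤ M := by
      rw [(Finset.mem_piAntidiag.1 ha).1]
      exact Nat.lt_succ_iff.1 (Finset.mem_range.1 hp)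
    have hle : l2Norm (ballB n r) (weakDeriv (ballB n r) a (planeHarmonic i j c N)) ≤ V * L := by
      rw [l2Norm, eLpNorm_congr_ae (hw.weakDeriv_ae_eq Metric.isOpen_ball)]
      refine (hVle c' m').trans ?_
      refine mul_le_mul_of_nonneg_left (hK.trans ?_) hV
      refine mul_le_mul_of_nonneg_left ?_ (by positivity)
      have h0 : (0 : ℝ) ≤ N / r := by positivity
      calc (N / r : ℝ) ^ (∑ l, a l) ≤ (1 + N / r) ^ (∑ l, a l) := by gcongr; linarith
        _ ≤ (1 + N / r) ^ M := pow_le_pow_right₀ (by linarith) hsum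
    rw [mul_one]
    exact pow_le_pow_left₀ ENNReal.toReal_nonneg hle 2
  calc hNorm M (ballB n r) (planeHarmonic i j c N) ≤ √((V * L) ^ 2 * T) := by
        refine Real.sqrt_le_sqrt ?_
        rw [hT, Finset.mul_sum]
        refine Finset.sum_le_sum fun p hp => ?_
        rw [Finset.mul_sum]
        exact Finset.sum_le_sum (hterm p hp)
    _ = √T * V * L := by
        rw [Real.sqrt_mul (by positivity), Real.sqrt_sq (by positivity)]
        ring

/-- The real and imaginary parts of `zᴺ` together have `L²` norm at least `b sᴺ` on `B(r)`,
for every `s < r`, because `|z| > s` on a nonempty open part of the ball. -/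
lemma exists_le_l2Norm_planeHarmonic {n : ℕ} {i j : Fin n} (hij : i ≠ j) {s r : ℝ} (hs : 0 < s)
    (hsr : s < r) : ∃ b : ℝ, 0 < b ∧ ∀ N : ℕ, b * s ^ N ≤
      l2Norm (ballB n r) (planeHarmonic i j 1 N) +
        l2Norm (ballB n r) (planeHarmonic i j (-Complex.I) N) := by
  set S : Set (Euc n) := {x | s < ‖planeCoord i j x‖}
  have hSo : IsOpen S := isOpen_lt continuous_const (planeCoord i j).continuous.norm
  set ν : Measure (Euc n) := volume.restrict (ballB n r)
  have hpos : 0 < ν S := by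
    rw [Measure.restrict_apply hSo.measurableSet]
    refine (hSo.inter Metric.isOpen_ball).measure_pos _
      ⟨((s + r) / 2) • EuclideanSpace.single i (1 : ℝ), ?_, ?_⟩
    · change s < ‖planeCoord i j _‖
      rw [map_smul, planeCoord_single hij, if_pos rfl, norm_smul, norm_one, mul_one,
        Real.norm_of_nonneg (by linarith)]
      linarith
    · rw [mem_ball_zero_iff, norm_smul, Real.norm_of_nonneg (by linarith)]
      rw [PiLp.norm_single, norm_one, mul_one]
      linarith
  refine ⟨(ν S ^ (1 / (2 : ENNReal).toReal)).toReal, ENNReal.toReal_pos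
    (ENNReal.rpow_pos hpos (measure_ne_top _ _)).ne'
    (ENNReal.rpow_ne_top_of_nonneg (by simp) (measure_ne_top _ _)), fun N => ?_⟩
  have hRe := memLp_planeHarmonic hij 1 N r
  have hIm := memLp_planeHarmonic hij (-Complex.I) N r
  have hle : eLpNorm (S.indicator fun _ => s ^ N) 2 ν ≤
      eLpNorm (planeHarmonic i j 1 N) 2 ν + eLpNorm (planeHarmonic i j (-Complex.I) N) 2 ν := by
    rw [← eLpNorm_norm (planeHarmonic i j 1 N), ← eLpNorm_norm (planeHarmonic i j (-Complex.I) N)]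
    refine le_trans (eLpNorm_mono_real fun x => ?_)
      (eLpNorm_add_le hRe.1.norm hIm.1.norm (by norm_num))
    simp only [Pi.add_apply]
    by_cases hx : x ∈ S
    · rw [Set.indicator_of_mem hx, Real.norm_of_nonneg (by positivity)]
      calc s ^ N ≤ ‖planeCoord i j x‖ ^ N := by gcongr; exact le_of_lt hx
        _ = ‖planeCoord i j x ^ N‖ := (norm_pow _ _).symm
        _ ≤ |(planeCoord i j x ^ N).re| + |(planeCoord i j x ^ N).im| :=
          Complex.norm_le_abs_re_add_abs_im _
        _ = ‖planeHarmonic i j 1 N x‖ + ‖planeHarmonic i j (-Complex.I) N x‖ := by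
          simp [planeHarmonic]
    · rw [Set.indicator_of_notMem hx, norm_zero]
      positivity
  rw [eLpNorm_indicator_const hSo.measurableSet (by norm_num) (by norm_num)] at hle
  have h := ENNReal.toReal_mono (ENNReal.add_ne_top.2 ⟨hRe.2.ne, hIm.2.ne⟩) hle
  rw [ENNReal.toReal_add hRe.2.ne hIm.2.ne, ENNReal.toReal_mul, toReal_enorm,
    Real.norm_of_nonneg (by positivity), mul_comm] at h
  exact h

/-! ### Consequences of the error bound -/

/-- The error bound forces a conditional stability estimate: testing with the zero function
shows that `F_h(0) = 0` on `B(r₂)`, and the perturbation `δq = -u|_{B(r₁)}` then makes the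
reconstruction vanish. -/
lemma ErrorBound.exists_stability {n k : ℕ} {r₁ r₂ r₃ R : ℝ} (h₃ : r₂ < r₃) (hr₃ : 0 < r₃)
    {F : {h : ℝ // 0 < h} → L2Space (ballB n r₁) → SobolevH 1 (ballB n r₃)} {α₁ α₂ : ℝ}
    (hF : ErrorBound n k r₁ r₂ r₃ R F α₁ α₂) {i j : Fin n} (hij : i ≠ j) :
    ∃ C : ℝ, 0 ≤ C ∧ ∀ h : ℝ, 0 < h → ∀ (c : ℂ) (N : ℕ),
      l2Norm (ballB n r₂) (planeHarmonic i j c N) ≤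
        C * (h ^ (α₁ * k) * hNorm (k + 1) (ballB n r₃) (planeHarmonic i j c N)
          + h ^ ((α₂ - 1) * k) * l2Norm (ballB n r₁) (planeHarmonic i j c N)) := by
  obtain ⟨C, hC⟩ := hF
  refine ⟨|C|, abs_nonneg C, fun h hh c N => ?_⟩
  set G : Euc n → ℝ := ((F ⟨h, hh⟩ 0 : L2Space (ballB n r₃)) : Euc n → ℝ)
  -- both tests perturb the data by the negative of the true data
  have key (c : ℂ) (N : ℕ) : l2Norm (ballB n r₂) (fun x => planeHarmonic i j c N x - G x) ≤
      C * (h ^ (α₁ * k) * hNorm (k + 1) (ballB n r₃) (planeHarmonic i j c N)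
          + h ^ ((α₂ - 1) * k) * l2Norm (ballB n r₁) (planeHarmonic i j c N)) := by
    have hmem := memLp_planeHarmonic hij c N r₁
    have := hC ⟨h, hh⟩ (planeHarmonic i j c N) (hmem.toLp _) (-hmem.toLp _)
      (memH_planeHarmonic hij c N (k + 1) R) (harmonicOnNhd_planeHarmonic hij c N _)
      hmem.coeFn_toLp
    rwa [add_neg_cancel, norm_neg, Lp.norm_toLp] at this
  have hzero : planeHarmonic i j (0 : ℂ) 0 = 0 := by
    ext x
    simp [planeHarmonic]
  have hGmem : MemLp G 2 (volume.restrict (ballB n r₂)) :=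
    (Lp.memLp _).mono_measure (Measure.restrict_mono (Metric.ball_subset_ball h₃.le) le_rfl)
  have hG0 : G =ᵐ[volume.restrict (ballB n r₂)] 0 := by
    have h0 := key 0 0
    have hN : hNorm (k + 1) (ballB n r₃) (planeHarmonic i j (0 : ℂ) 0) = 0 := by
      obtain ⟨A, -, hA⟩ := exists_hNorm_planeHarmonic_le hij (k + 1) hr₃
      exact le_antisymm (by simpa using hA 0 0) (Real.sqrt_nonneg _)
    have hL : l2Norm (ballB n r₁) (planeHarmonic i j (0 : ℂ) 0) = 0 := by
      simp [l2Norm, hzero]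
    have hneg : (fun x => planeHarmonic i j (0 : ℂ) 0 x - G x) = -G := by
      ext x
      simp [hzero]
    rw [hN, hL, mul_zero, mul_zero, add_zero, mul_zero, l2Norm, hneg, eLpNorm_neg] at h0
    have h1 := (ENNReal.toReal_eq_zero_iff _).1 (le_antisymm h0 ENNReal.toReal_nonneg)
    exact (eLpNorm_eq_zero_iff hGmem.1 (by norm_num)).1 (h1.resolve_right hGmem.2.ne)
  have hcongr : l2Norm (ballB n r₂) (fun x => planeHarmonic i j c N x - G x) =
      l2Norm (ballB n r₂) (planeHarmonic i j c N) := by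
    rw [l2Norm, l2Norm]
    congr 1
    refine eLpNorm_congr_ae ?_
    filter_upwards [hG0] with x hx
    simp [hx]
  rw [← hcongr]
  refine (key c N).trans (mul_le_mul_of_nonneg_right (le_abs_self C) ?_)
  have h1 : 0 ≤ hNorm (k + 1) (ballB n r₃) (planeHarmonic i j c N) := Real.sqrt_nonneg _
  have h2 : 0 ≤ l2Norm (ballB n r₁) (planeHarmonic i j c N) := ENNReal.toReal_nonneg
  positivity

/-! ### The optimal exponent -/

/-- The value of `h` which balances the two terms of the error bound on `zᴺ`. -/
lemma exists_balancing_scale {r₁ r₃ α₁ α₂ : ℝ} {k : ℕ} (hk : 1 ≤ k) (h₁ : 0 < r₁) (hr₃ : 0 < r₃)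
    (hα : 0 < 1 + α₁ - α₂) (N : ℕ) :
    ∃ h : ℝ, 0 < h ∧
      h ^ (α₁ * k) * r₃ ^ N = (r₃ * (r₁ / r₃) ^ (α₁ / (1 + α₁ - α₂))) ^ N ∧
      h ^ ((α₂ - 1) * k) * r₁ ^ N = (r₃ * (r₁ / r₃) ^ (α₁ / (1 + α₁ - α₂))) ^ N := by
  have hw : 0 < r₁ / r₃ := by positivity
  have hk0 : (k : ℝ) ≠ 0 := by positivity
  refine ⟨(r₁ / r₃) ^ ((N : ℝ) / ((1 + α₁ - α₂) * k)), by positivity, ?_, ?_⟩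
  · rw [← Real.rpow_mul hw.le, show (N : ℝ) / ((1 + α₁ - α₂) * k) * (α₁ * k) =
      α₁ / (1 + α₁ - α₂) * N by field_simp, Real.rpow_mul_natCast hw.le, ← mul_pow, mul_comm]
  · rw [← Real.rpow_mul hw.le, show (N : ℝ) / ((1 + α₁ - α₂) * k) * ((α₂ - 1) * k) =
      (α₁ / (1 + α₁ - α₂) - 1) * N by field_simp; ring, Real.rpow_mul_natCast hw.le, ← mul_pow,
      Real.rpow_sub_one hw.ne']
    congr 1
    field_simp

/-- `r₃ (r₁/r₃)^β < r₂` for every exponent `β` above the three-ball exponent. -/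
lemma mul_rpow_lt_of_threeBallExponent_lt {r₁ r₂ r₃ β : ℝ} (h₁ : 0 < r₁) (h₂ : r₁ < r₂)
    (h₃ : r₂ < r₃) (hβ : threeBallExponent r₁ r₂ r₃ < β) : r₃ * (r₁ / r₃) ^ β < r₂ := by
  have hr₂ : 0 < r₂ := h₁.trans h₂
  have hr₃ : 0 < r₃ := hr₂.trans h₃
  have hw : 0 < r₁ / r₃ := by positivity
  have hlog : 0 < Real.log r₃ - Real.log r₁ := sub_pos.2 (Real.log_lt_log h₁ (h₂.trans h₃))
  rw [threeBallExponent, div_lt_iff₀ hlog] at hβ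
  rw [← Real.log_lt_log_iff (by positivity) hr₂, Real.log_mul hr₃.ne' (by positivity),
    Real.log_rpow hw, Real.log_div h₁.ne' hr₃.ne']
  linarith

lemma threeBallExponent_mem_Ioo {r₁ r₂ r₃ : ℝ} (h₁ : 0 < r₁) (h₂ : r₁ < r₂) (h₃ : r₂ < r₃) :
    threeBallExponent r₁ r₂ r₃ ∈ Set.Ioo 0 1 := by
  have h12 := Real.log_lt_log h₁ h₂
  have h23 := Real.log_lt_log (h₁.trans h₂) h₃
  rw [threeBallExponent, Set.mem_Ioo, div_lt_one (by linarith)]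
  exact ⟨div_pos (by linarith) (by linarith), by linarith⟩

/-- Exponential decay beats polynomial growth, so no such estimate holds for all `N`. -/
lemma not_forall_mul_pow_le {b A V r s ρ : ℝ} (M : ℕ) (hb : 0 < b) (hA : 0 ≤ A)
    (hr : 0 < r) (hρ : 0 ≤ ρ) (hρs : ρ < s)
    (h : ∀ N : ℕ, b * s ^ N ≤ A * ((1 + N / r) ^ M * ρ ^ N) + V * ρ ^ N) : False := by
  have hs : 0 < s := hρ.trans_lt hρs
  have hx0 : 0 ≤ ρ / s := by positivity
  have hx1 : ρ / s < 1 := (div_lt_one hs).2 hρs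
  have hlim : Filter.Tendsto (fun N : ℕ => A * (1 + 1 / r) ^ M * ((N : ℝ) ^ M * (ρ / s) ^ N) +
      V * (ρ / s) ^ N) Filter.atTop (nhds 0) := by
    simpa using ((tendsto_pow_const_mul_const_pow_of_lt_one M hx0 hx1).const_mul
      (A * (1 + 1 / r) ^ M)).add ((tendsto_pow_atTop_nhds_zero_of_lt_one hx0 hx1).const_mul V)
  refine hb.not_ge (ge_of_tendsto hlim ?_)
  filter_upwards [Filter.eventually_ge_atTop 1] with N hN
  have hN1 : (1 : ℝ) ≤ N := by exact_mod_cast hN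
  have hle : (1 + N / r : ℝ) ≤ (1 + 1 / r) * N := by
    rw [add_mul, one_mul, one_div_mul_eq_div]
    linarith
  have hpow : (1 + N / r : ℝ) ^ M ≤ (1 + 1 / r) ^ M * (N : ℝ) ^ M := by
    rw [← mul_pow]
    gcongr
  refine le_of_mul_le_mul_right ?_ (pow_pos hs N)
  calc b * s ^ N ≤ A * ((1 + N / r) ^ M * ρ ^ N) + V * ρ ^ N := h N
    _ ≤ A * ((1 + 1 / r) ^ M * (N : ℝ) ^ M * ρ ^ N) + V * ρ ^ N := by gcongr
    _ = _ := by
      rw [div_pow]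
      field_simp

/-- Both terms of the stability estimate for `zᴺ`, at the balancing scale, are `O(ρᴺ)` up to
polynomial factors, while the left-hand side grows faster, since `ρ < r₂`. -/
lemma not_errorBound {n k : ℕ} (hn : 2 ≤ n) (hk : 1 ≤ k) {r₁ r₂ r₃ R : ℝ} (h₁ : 0 < r₁)
    (h₂ : r₁ < r₂) (h₃ : r₂ < r₃)
    (F : {h : ℝ // 0 < h} → L2Space (ballB n r₁) → SobolevH 1 (ballB n r₃)) {α₁ α₂ : ℝ}
    (hα : 0 < 1 + α₁ - α₂) (hβ : threeBallExponent r₁ r₂ r₃ < α₁ / (1 + α₁ - α₂)) :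
    ¬ ErrorBound n k r₁ r₂ r₃ R F α₁ α₂ := by
  intro hF
  have hr₃ : 0 < r₃ := (h₁.trans h₂).trans h₃
  have hij : (⟨0, by omega⟩ : Fin n) ≠ ⟨1, by omega⟩ := by simp
  set ρ : ℝ := r₃ * (r₁ / r₃) ^ (α₁ / (1 + α₁ - α₂)) with hρ
  have hρ0 : 0 < ρ := by positivity
  -- leave room between the decay rate `ρ` and `r₂` for the lower bound on `‖zᴺ‖`
  obtain ⟨s, hρs, hsr⟩ := exists_between (mul_rpow_lt_of_threeBallExponent_lt h₁ h₂ h₃ hβ)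
  obtain ⟨b, hb, hlow⟩ := exists_le_l2Norm_planeHarmonic hij (hρ0.trans hρs) hsr
  obtain ⟨C, hC, hstab⟩ := hF.exists_stability h₃ hr₃ hij
  obtain ⟨A, hA, hup⟩ := exists_hNorm_planeHarmonic_le hij (k + 1) hr₃
  obtain ⟨V, hV, hdata⟩ := exists_l2Norm_planeHarmonic_le hij h₁
  refine not_forall_mul_pow_le (k + 1) hb (by positivity : 0 ≤ 2 * C * A) hr₃ hρ0.le hρs
    (V := 2 * C * V) fun N => ?_
  obtain ⟨h, hh, hbal₃, hbal₁⟩ := exists_balancing_scale hk h₁ hr₃ hα N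
  have hone (c : ℂ) (hc : ‖c‖ = 1) :
      l2Norm (ballB n r₂) (planeHarmonic ⟨0, by omega⟩ ⟨1, by omega⟩ c N) ≤
        C * (A * ((1 + N / r₃) ^ (k + 1) * ρ ^ N) + V * ρ ^ N) := by
    refine (hstab h hh c N).trans (mul_le_mul_of_nonneg_left ?_ hC)
    have e₃ := mul_le_mul_of_nonneg_left (hup c N) (Real.rpow_nonneg hh.le (α₁ * k))
    have e₁ := mul_le_mul_of_nonneg_left (hdata c N) (Real.rpow_nonneg hh.le ((α₂ - 1) * k))
    rw [hc, one_mul] at e₃ e₁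
    refine (add_le_add e₃ e₁).trans_eq ?_
    rw [hρ, ← hbal₃]
    nth_rewrite 2 [hbal₃]
    rw [← hbal₁]
    ring
  calc b * s ^ N ≤ _ := hlow N
    _ ≤ _ := add_le_add (hone 1 norm_one) (hone (-Complex.I) (by simp))
    _ = _ := by ring

theorem theorem2 (n : ℕ) (hn : n = 2 ∨ n = 3) (k : ℕ) (hk : 1 ≤ k) (r₁ r₂ r₃ R : ℝ)
    (h₁ : 0 < r₁) (h₂ : r₁ < r₂) (h₃ : r₂ < r₃) (hR : r₃ < R)
    (F : {h : ℝ // 0 < h} → L2Space (ballB n r₁) → SobolevH 1 (ballB n r₃)) :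
    (¬ ∃ α₁ ∈ Set.Ioo (0 : ℝ) 1, ∃ α₂ ∈ Set.Ioo (0 : ℝ) 1,
      α₁ / (1 + α₁ - α₂) > threeBallExponent r₁ r₂ r₃ ∧ ErrorBound n k r₁ r₂ r₃ R F α₁ α₂) ∧
    (¬ ∃ α₁ ∈ Set.Ico (threeBallExponent r₁ r₂ r₃) 1,
      ∃ α₂ ∈ Set.Ico (threeBallExponent r₁ r₂ r₃) 1,
      (α₁ > threeBallExponent r₁ r₂ r₃ ∨ α₂ > threeBallExponent r₁ r₂ r₃) ∧
        ErrorBound n k r₁ r₂ r₃ R F α₁ α₂) := by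
  have hn2 : 2 ≤ n := by omega
  obtain ⟨hα0, hα1⟩ := threeBallExponent_mem_Ioo h₁ h₂ h₃
  refine ⟨?_, ?_⟩
  · rintro ⟨α₁, ⟨hα₁, -⟩, α₂, ⟨-, hα₂⟩, hβ, hF⟩
    exact not_errorBound hn2 hk h₁ h₂ h₃ F (by linarith) hβ hF
  · rintro ⟨α₁, ⟨hα₁, hα₁'⟩, α₂, ⟨hα₂, hα₂'⟩, hor, hF⟩
    have hpos : 0 < 1 + α₁ - α₂ := by linarith
    refine not_errorBound hn2 hk h₁ h₂ h₃ F hpos ?_ hF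
    rw [lt_div_iff₀ hpos]
    -- with `α` the three-ball exponent, the claim is `α (1 - α₂) < α₁ (1 - α)`
    rcases hor with hor | hor <;> nlinarith
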